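/- Let $N=\{1,\dots,n\}$ be a finite set of agents and $\mathrm{Prop}$ a countable set of atomic propositions. Consider the formulas $$\varphi ::= p \mid \neg\varphi \mid (\varphi\wedge\psi) \mid [C]\varphi \mid \mathrm{FI}_C(\varphi)\qquad (p\in\mathrm{Prop},\ C\subseteq N),$$ with $\to,\leftrightarrow$ the usual abbreviations, $\bot$ abbreviating any contradiction $\psi\wedge\neg\psi$, and $\top=\neg\bot$. The proof system $\mathrm{CL}^{\mathrm{FI}}$ has as axioms all instances, in this language, of: propositional tautologies; $\neg[C]\bot$; $[C]\top$; $\neg[\emptyset]\neg\varphi\to[N]\varphi$; $[C](\varphi\wedge\psi)\to[C]\psi$; $([C]\varphi\wedge[D]\psi)\to[C\cup D](\varphi\wedge\psi)$ for $C\cap D=\emptyset$; and $\mathrm{FI}_C(\varphi)\leftrightarrow(\neg[C]\varphi\wedge\neg[C]\neg\varphi)$. Its rules are modus ponens and: from $\varphi\leftrightarrow\psi$ infer $[C]\varphi\leftrightarrow[C]\psi$. A coalition model $(W,E,V)$ consists of a non-empty set $W$, a map assigning to every $w\in W$ and $C\subseteq N$ a family $E_w(C)\subseteq\mathcal P(W)$,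 and a valuation $V:\mathrm{Prop}\to\mathcal P(W)$. It is playable if for all $w\in W$, $C,D\subseteq N$ and $X,Y\subseteq W$: $\emptyset\notin E_w(C)$; $W\in E_w(C)$; $X\in E_w(C)$ and $X\subseteq Y$ imply $Y\in E_w(C)$; $C\cap D=\emptyset$, $X\in E_w(C)$ and $Y\in E_w(D)$ imply $X\cap Y\in E_w(C\cup D)$; and $X\notin E_w(\emptyset)$ if and only if $W\setminus X\in E_w(N)$. Let $[\![\varphi]\!]$ be the set of states at which $\varphi$ is true, where atoms are interpreted by $V$, Boolean connectives classically, $[C]\varphi$ is true at $w$ iff $[\![\varphi]\!]\in E_w(C)$, and $\mathrm{FI}_C(\varphi)$ is true at $w$ iff $[\![\varphi]\!]\notin E_w(C)$ and $W\setminus[\![\varphi]\!]\notin E_w(C)$. **Theorem (Soundness and Completeness).** The system $\mathrm{CL}^{\mathrm{FI}}$ is sound and complete with respect to the class of playable coalition models: for every formula $\varphi$, (soundness) if $\varphi$ is derivable in $\mathrm{CL}^{\mathrm{FI}}$, then $\varphi$ is true at every state of every playable coalition model; and (completeness) if $\varphi$ is true at every state of every playable coalition model, then $\varphi$ is derivable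 in $\mathrm{CL}^{\mathrm{FI}}$. -/

import Mathlib

universe u v w

namespace CLFI

/-- Formulas of the coalition language with a primitive Full Inability modality, over the agents
`Fin n` and the atomic propositions `P`. A coalition is an arbitrary set of agents. -/
inductive Formula (n : ℕ) (P : Type u) : Type u where
  | atom (p : P) : Formula n P
  | neg (φ : Formula n P) : Formula n P
  | conj (φ ψ : Formula n P) : Formula n P
  | eff (C : Set (Fin n)) (φ : Formula n P) : Formula n P
  | fi (C : Set (Fin n)) (φ : Formula n P) : Formula n P

namespace Formula

variable {n : ℕ} {P : Type u}

/-- Material implication, as an abbreviation. -/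
def imp (φ ψ : Formula n P) : Formula n P := neg (conj φ (neg ψ))

/-- The biconditional, as an abbreviation. -/
def iff (φ ψ : Formula n P) : Formula n P := conj (imp φ ψ) (imp ψ φ)

/-- The contradiction `ψ ∧ ¬ψ`. The grammar has no constant for falsum, so `⊥` is any of these. -/
def falsum (ψ : Formula n P) : Formula n P := conj ψ (neg ψ)

/-- `⊤` as the negation of a contradiction. -/
def verum (ψ : Formula n P) : Formula n P := neg (falsum ψ)

/-- Propositional tautologies of the language: formulas true under every truth assignment that
respects negation and conjunction (atoms and modal formulas being assigned arbitrarily). -/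
def IsTautology (φ : Formula n P) : Prop :=
  ∀ v : Formula n P → Prop,
    (∀ ψ, v (neg ψ) ↔ ¬ v ψ) → (∀ ψ χ, v (conj ψ χ) ↔ v ψ ∧ v χ) → v φ

end Formula

/-- Derivability in the system `CL^FI`. -/
inductive Derivable {n : ℕ} {P : Type u} : Formula n P → Prop where
  /-- Propositional tautologies. -/
  | pl (φ : Formula n P) (h : φ.IsTautology) : Derivable φ
  /-- `¬[C]⊥` -/
  | bot (C : Set (Fin n)) (ψ : Formula n P) : Derivable (.neg (.eff C (.falsum ψ)))
  /-- `[C]⊤` -/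
  | top (C : Set (Fin n)) (ψ : Formula n P) : Derivable (.eff C (.verum ψ))
  /-- `¬[∅]¬φ → [N]φ` -/
  | nMax (φ : Formula n P) :
      Derivable (.imp (.neg (.eff ∅ (.neg φ))) (.eff Set.univ φ))
  /-- `[C](φ ∧ ψ) → [C]ψ` -/
  | mono (C : Set (Fin n)) (φ ψ : Formula n P) :
      Derivable (.imp (.eff C (.conj φ ψ)) (.eff C ψ))
  /-- `[C]φ ∧ [D]ψ → [C ∪ D](φ ∧ ψ)` for disjoint `C` and `D` -/
  | superadd (C D : Set (Fin n)) (h : C ∩ D = ∅) (φ ψ : Formula n P) :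
      Derivable (.imp (.conj (.eff C φ) (.eff D ψ)) (.eff (C ∪ D) (.conj φ ψ)))
  /-- `FI_C(φ) ↔ ¬[C]φ ∧ ¬[C]¬φ` -/
  | defFI (C : Set (Fin n)) (φ : Formula n P) :
      Derivable (.iff (.fi C φ) (.conj (.neg (.eff C φ)) (.neg (.eff C (.neg φ)))))
  /-- Modus ponens. -/
  | mp (φ ψ : Formula n P) (h₁ : Derivable (.imp φ ψ)) (h₂ : Derivable φ) : Derivable ψ
  /-- From `φ ↔ ψ` infer `[C]φ ↔ [C]ψ`. -/
  | re (C : Set (Fin n)) (φ ψ : Formula n P) (h : Derivable (.iff φ ψ)) :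
      Derivable (.iff (.eff C φ) (.eff C ψ))

/-- A coalition model: a non-empty set of states, an effectivity function at every state, and a
valuation. -/
structure CoalitionModel (n : ℕ) (P : Type u) where
  W : Type w
  nonempty : Nonempty W
  E : W → Set (Fin n) → Set (Set W)
  V : P → Set W

/-- Playability of an effectivity function on the state set `W`. -/
structure IsPlayable {n : ℕ} {W : Type w} (E : Set (Fin n) → Set (Set W)) : Prop where
  liveness : ∀ C, ∅ ∉ E C
  safety : ∀ C, Set.univ ∈ E C
  outcomeMono : ∀ C X Y, X ∈ E C → X ⊆ Y → Y ∈ E C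
  superadditive : ∀ C D X Y, C ∩ D = ∅ → X ∈ E C → Y ∈ E D → X ∩ Y ∈ E (C ∪ D)
  nMaximal : ∀ X : Set W, X ∉ E ∅ ↔ Xᶜ ∈ E Set.univ

namespace CoalitionModel

variable {n : ℕ} {P : Type u}

/-- A coalition model is playable if its effectivity function is playable at every state. -/
def Playable (M : CoalitionModel.{u, w} n P) : Prop := ∀ s : M.W, IsPlayable (M.E s)

/-- The truth set of a formula in a coalition model. -/
def truthSet (M : CoalitionModel.{u, w} n P) : Formula n P → Set M.W
  | .atom p => M.V p
  | .neg φ => (M.truthSet φ)ᶜ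
  | .conj φ ψ => M.truthSet φ ∩ M.truthSet ψ
  | .eff C φ => {s | M.truthSet φ ∈ M.E s C}
  | .fi C φ => {s | M.truthSet φ ∉ M.E s C ∧ (M.truthSet φ)ᶜ ∉ M.E s C}

/-- Satisfaction of a formula at a state of a coalition model. -/
def Sat (M : CoalitionModel.{u, w} n P) (s : M.W) (φ : Formula n P) : Prop := s ∈ M.truthSet φ

end CoalitionModel

/-- Validity over the class of playable coalition models (with state sets in `Type w`). -/
def Valid {n : ℕ} {P : Type u} (φ : Formula n P) : Prop :=
  ∀ M : CoalitionModel.{u, w} n P, M.Playable → ∀ s : M.W, M.Sat s φ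

end CLFI

namespace CLFI

open Formula

section Soundness

variable {n : ℕ} {P : Type u}

/-! Soundness is an induction on derivations. Completeness uses a canonical model whose states are
the maximal consistent sets, so that every underivable formula fails at some state
(`exists_not_holds`). At `w`, a coalition `C ≠ N` is effective for the supersets of proof sets of
formulas `φ` with `[C]φ ∈ w`; `N` is effective for `X` exactly when `∅` does not force the
complement of `X`, which builds in N-maximality. This is playable when there is an agent
(`effectivity_isPlayable`); without agents `∅ = N` and a principal ultrafilter replaces it. Either
way `[[φ]] ∈ E_w(C)` iff `[C]φ ∈ w`, which drives the truth lemma; `FI` reduces to it by its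
defining axiom. -/

theorem CoalitionModel.sat_neg {M : CoalitionModel.{u, w} n P} {s : M.W} {φ : Formula n P} :
    M.Sat s (.neg φ) ↔ ¬ M.Sat s φ := Iff.rfl

theorem CoalitionModel.sat_conj {M : CoalitionModel.{u, w} n P} {s : M.W} {φ ψ : Formula n P} :
    M.Sat s (.conj φ ψ) ↔ M.Sat s φ ∧ M.Sat s ψ := Iff.rfl

theorem CoalitionModel.sat_imp {M : CoalitionModel.{u, w} n P} {s : M.W} {φ ψ : Formula n P} :
    M.Sat s (imp φ ψ) ↔ (M.Sat s φ → M.Sat s ψ) := by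
  simp only [imp, sat_neg, sat_conj]; tauto

theorem CoalitionModel.sat_iff {M : CoalitionModel.{u, w} n P} {s : M.W} {φ ψ : Formula n P} :
    M.Sat s (Formula.iff φ ψ) ↔ (M.Sat s φ ↔ M.Sat s ψ) := by
  simp only [Formula.iff, sat_conj, sat_imp]; tauto

theorem CoalitionModel.truthSet_falsum (M : CoalitionModel.{u, w} n P) (ψ : Formula n P) :
    M.truthSet (falsum ψ) = ∅ := Set.inter_compl_self _

theorem CoalitionModel.truthSet_verum (M : CoalitionModel.{u, w} n P) (ψ : Formula n P) :
    M.truthSet (verum ψ) = Set.univ := by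
  change (M.truthSet (falsum ψ))ᶜ = _
  rw [M.truthSet_falsum, Set.compl_empty]

open CoalitionModel in
theorem Derivable.valid {φ : Formula n P} (h : Derivable φ) : Valid.{u, w} φ := by
  intro M hM
  induction h with
  | pl φ h => exact fun s => h (M.Sat s) (fun _ => sat_neg) (fun _ _ => sat_conj)
  | bot C ψ =>
    intro s hs
    exact (hM s).liveness C (M.truthSet_falsum ψ ▸ hs)
  | top C ψ =>
    intro s
    change M.truthSet (verum ψ) ∈ M.E s C
    exact M.truthSet_verum ψ ▸ (hM s).safety C
  | nMax φ =>
    intro s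
    rw [sat_imp]
    intro h
    have := ((hM s).nMaximal (M.truthSet φ)ᶜ).1 h
    rwa [compl_compl] at this
  | mono C φ ψ =>
    intro s
    rw [sat_imp]
    exact fun h => (hM s).outcomeMono C _ _ h Set.inter_subset_right
  | superadd C D hCD φ ψ =>
    intro s
    rw [sat_imp]
    exact fun h => (hM s).superadditive C D _ _ hCD h.1 h.2
  | defFI C φ =>
    intro s
    rw [sat_iff]
    exact Iff.rfl
  | mp φ ψ _ _ ih₁ ih₂ => exact fun s => sat_imp.1 (ih₁ s) (ih₂ s)
  | re C φ ψ _ ih =>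
    intro s
    rw [sat_iff]
    have : M.truthSet φ = M.truthSet ψ := Set.ext fun t => sat_iff.1 (ih t)
    change M.truthSet φ ∈ M.E s C ↔ M.truthSet ψ ∈ M.E s C
    rw [this]

end Soundness

section Completeness

variable {n : ℕ} {P : Type u}

/-! ### Lindenbaum's lemma -/

/-- A theory: a set of formulas that contains all theorems and is closed under modus ponens. -/
structure IsTheory (T : Set (Formula n P)) : Prop where
  derivable : ∀ φ, Derivable φ → φ ∈ T
  mp : ∀ φ ψ, imp φ ψ ∈ T → φ ∈ T → ψ ∈ T

/-- States of the canonical model: maximal consistent sets, presented as truth assignments that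
respect the connectives and make every theorem true. -/
structure CanonicalState (n : ℕ) (P : Type u) where
  holds : Formula n P → Prop
  neg : ∀ φ, holds (.neg φ) ↔ ¬ holds φ
  conj : ∀ φ ψ, holds (.conj φ ψ) ↔ holds φ ∧ holds ψ
  derivable : ∀ φ, Derivable φ → holds φ

/-- A deduction theorem: it holds because theories need only be closed under modus ponens, not under
the rule of equivalents. -/
theorem IsTheory.adjoin {T : Set (Formula n P)} (hT : IsTheory T) (ψ : Formula n P) :
    IsTheory {χ | imp ψ χ ∈ T} where
  derivable χ hχ := hT.mp χ _
    (hT.derivable _ (.pl _ fun v hn hc => by simp only [imp, hn, hc]; tauto))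
    (hT.derivable _ hχ)
  mp χ ξ h₁ h₂ := hT.mp _ _ (hT.mp (imp ψ (imp χ ξ)) (imp (imp ψ χ) (imp ψ ξ))
    (hT.derivable _ (.pl _ fun v hn hc => by simp only [imp, hn, hc]; tauto)) h₁) h₂

theorem exists_maximal_theory {φ : Formula n P} (h : ¬ Derivable φ) :
    ∃ T : Set (Formula n P), Maximal (fun T => IsTheory T ∧ φ ∉ T) T := by
  have chain : ∀ c ⊆ {T : Set (Formula n P) | IsTheory T ∧ φ ∉ T}, IsChain (· ⊆ ·) c →
      c.Nonempty → ∃ ub ∈ {T : Set (Formula n P) | IsTheory T ∧ φ ∉ T}, ∀ S ∈ c, S ⊆ ub := by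
    rintro c hc hchain ⟨S, hS⟩
    refine ⟨⋃₀ c, ⟨⟨fun ψ hψ => ⟨S, hS, (hc hS).1.derivable ψ hψ⟩, ?_⟩, ?_⟩,
      fun _ => Set.subset_sUnion_of_mem⟩
    · rintro ψ χ ⟨A, hA, h₁⟩ ⟨B, hB, h₂⟩
      rcases hchain.total hA hB with hAB | hBA
      · exact ⟨B, hB, (hc hB).1.mp ψ χ (hAB h₁) h₂⟩
      · exact ⟨A, hA, (hc hA).1.mp ψ χ h₁ (hBA h₂)⟩
    · rintro ⟨A, hA, h₁⟩
      exact (hc hA).2 h₁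
  -- The empty union is no theory, so Zorn starts from the set of theorems.
  obtain ⟨T, -, hT⟩ := zorn_subset_nonempty _ chain {ψ | Derivable ψ}
    ⟨⟨fun _ => id, Derivable.mp⟩, h⟩
  exact ⟨T, hT⟩

theorem CanonicalState.exists_not_holds {φ : Formula n P} (h : ¬ Derivable φ) :
    ∃ w : CanonicalState n P, ¬ w.holds φ := by
  obtain ⟨T, ⟨hT, hφ⟩, hmax⟩ := exists_maximal_theory h
  have taut : ∀ {ψ}, ψ.IsTautology → ψ ∈ T := fun hψ => hT.derivable _ (.pl _ hψ)
  -- Otherwise adjoining `ψ` gives a larger theory omitting `φ`. Hence if `T` omits both `ψ` and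
  -- `¬ψ`, case distinction puts `φ` in `T`.
  have key : ∀ ψ, ψ ∉ T → imp ψ φ ∈ T := by
    intro ψ hψ
    by_contra hn
    refine hψ (hmax ⟨hT.adjoin ψ, hn⟩ (fun χ hχ => hT.mp χ _ (taut fun v hn hc => ?_) hχ)
      (taut fun v hn hc => ?_ : imp ψ ψ ∈ T)) <;>
    · simp only [imp, hn, hc]; tauto
  refine ⟨⟨(· ∈ T), fun ψ => ⟨fun h₁ h₂ => hφ ?_, fun h₁ => ?_⟩,
    fun ψ χ => ⟨fun h => ⟨?_, ?_⟩, fun h => ?_⟩, hT.derivable⟩, hφ⟩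
  · refine hT.mp _ _ (hT.mp _ _ (taut fun v hn hc => ?_) h₁) h₂
    simp only [imp, hn, hc]; tauto
  · by_contra h₂
    refine hφ (hT.mp _ _ (hT.mp _ _ (taut fun v hn hc => ?_) (key _ h₁)) (key _ h₂))
    simp only [imp, hn, hc]; tauto
  · refine hT.mp _ _ (taut fun v hn hc => ?_) h
    simp only [imp, hn, hc]; tauto
  · refine hT.mp _ _ (taut fun v hn hc => ?_) h
    simp only [imp, hn, hc]; tauto
  · refine hT.mp _ _ (hT.mp _ _ (taut fun v hn hc => ?_) h.1) h.2
    simp only [imp, hn, hc]; tauto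

/-! ### Canonical effectivity and its playability -/

namespace CanonicalState

theorem derivable_of_forall_holds {φ : Formula n P} (h : ∀ w : CanonicalState n P, w.holds φ) :
    Derivable φ := by
  by_contra hφ
  obtain ⟨w, hw⟩ := exists_not_holds hφ
  exact hw (h w)

theorem holds_imp (w : CanonicalState n P) {φ ψ : Formula n P} :
    w.holds (imp φ ψ) ↔ (w.holds φ → w.holds ψ) := by
  simp only [imp, w.neg, w.conj]; tauto

theorem holds_iff (w : CanonicalState n P) {φ ψ : Formula n P} :
    w.holds (Formula.iff φ ψ) ↔ (w.holds φ ↔ w.holds ψ) := by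
  simp only [Formula.iff, w.conj, w.holds_imp]; tauto

theorem holds_falsum (w : CanonicalState n P) (ψ : Formula n P) : ¬ w.holds (falsum ψ) := by
  simp only [falsum, w.neg, w.conj]; tauto

/-- The proof set of a formula: the canonical states at which it holds. -/
def proofSet (φ : Formula n P) : Set (CanonicalState n P) := {w | w.holds φ}

theorem eff_congr (w : CanonicalState n P) (C : Set (Fin n)) {φ ψ : Formula n P}
    (h : proofSet φ = proofSet ψ) : w.holds (.eff C φ) ↔ w.holds (.eff C ψ) :=
  w.holds_iff.1 <| w.derivable _ <| .re C φ ψ <| derivable_of_forall_holds fun t =>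
    t.holds_iff.2 (Set.ext_iff.1 h t)

/-- Under the inclusion, `φ` and `φ ∧ ψ` have the same proof set, so the monotonicity axiom applies.
-/
theorem eff_mono (w : CanonicalState n P) {C : Set (Fin n)} {φ ψ : Formula n P}
    (h : proofSet φ ⊆ proofSet ψ) (hφ : w.holds (.eff C φ)) : w.holds (.eff C ψ) :=
  w.holds_imp.1 (w.derivable _ (.mono C φ ψ)) <|
    (w.eff_congr C (Set.ext fun t => (t.conj φ ψ).trans (and_iff_left_of_imp (@h t)))).2 hφ

theorem eff_superadd (w : CanonicalState n P) {C D : Set (Fin n)} (h : C ∩ D = ∅)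
    {φ ψ : Formula n P} (hφ : w.holds (.eff C φ)) (hψ : w.holds (.eff D ψ)) :
    w.holds (.eff (C ∪ D) (.conj φ ψ)) :=
  w.holds_imp.1 (w.derivable _ (.superadd C D h φ ψ)) ((w.conj _ _).2 ⟨hφ, hψ⟩)

theorem nonempty_of_eff (w : CanonicalState n P) {C : Set (Fin n)} {φ : Formula n P}
    (hφ : w.holds (.eff C φ)) : (proofSet φ).Nonempty := by
  by_contra h
  rw [Set.not_nonempty_iff_eq_empty] at h
  refine (w.neg _).1 (w.derivable _ (.bot C φ)) (w.eff_mono ?_ hφ)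
  rw [h]
  exact Set.empty_subset _

theorem eff_of_eq_univ (w : CanonicalState n P) (C : Set (Fin n)) {φ : Formula n P}
    (h : proofSet φ = Set.univ) : w.holds (.eff C φ) :=
  w.eff_mono (h ▸ Set.subset_univ _) (w.derivable _ (.top C φ))

theorem eff_univ_iff (w : CanonicalState n P) (φ : Formula n P) :
    w.holds (.eff Set.univ φ) ↔ ¬ w.holds (.eff ∅ (.neg φ)) := by
  refine ⟨fun h₁ h₂ => ?_, fun h => w.holds_imp.1 (w.derivable _ (.nMax φ)) ((w.neg _).2 h)⟩
  obtain ⟨t, ht⟩ := w.nonempty_of_eff (w.eff_superadd (Set.inter_empty _) h₁ h₂)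
  exact t.holds_falsum φ ht

theorem proofSet_neg (φ : Formula n P) : proofSet (.neg φ) = (proofSet φ)ᶜ :=
  Set.ext fun t => t.neg φ

theorem proofSet_conj (φ ψ : Formula n P) :
    proofSet (.conj φ ψ) = proofSet φ ∩ proofSet ψ :=
  Set.ext fun t => t.conj φ ψ

/-- The sets that include the proof set of a formula which `C` can force according to `w`. -/
def forced (w : CanonicalState n P) (C : Set (Fin n)) : Set (Set (CanonicalState n P)) :=
  {X | ∃ φ, proofSet φ ⊆ X ∧ w.holds (.eff C φ)}

theorem forced_mono (w : CanonicalState n P) {C : Set (Fin n)} {X Y : Set (CanonicalState n P)}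
    (hX : X ∈ w.forced C) (hXY : X ⊆ Y) : Y ∈ w.forced C :=
  let ⟨φ, h, hφ⟩ := hX
  ⟨φ, h.trans hXY, hφ⟩

theorem proofSet_mem_forced (w : CanonicalState n P) {C : Set (Fin n)} {φ : Formula n P} :
    proofSet φ ∈ w.forced C ↔ w.holds (.eff C φ) :=
  ⟨fun ⟨_, h, hψ⟩ => w.eff_mono h hψ, fun h => ⟨φ, subset_rfl, h⟩⟩

theorem empty_notMem_forced (w : CanonicalState n P) (C : Set (Fin n)) : ∅ ∉ w.forced C :=
  fun ⟨_, h, hφ⟩ => (w.nonempty_of_eff hφ).ne_empty (Set.subset_empty_iff.1 h)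

theorem forced_superadd (w : CanonicalState n P) {C D : Set (Fin n)} (h : C ∩ D = ∅)
    {X Y : Set (CanonicalState n P)} (hX : X ∈ w.forced C) (hY : Y ∈ w.forced D) :
    X ∩ Y ∈ w.forced (C ∪ D) :=
  let ⟨φ, h₁, hφ⟩ := hX
  let ⟨ψ, h₂, hψ⟩ := hY
  ⟨.conj φ ψ, proofSet_conj φ ψ ▸ Set.inter_subset_inter h₁ h₂, w.eff_superadd h hφ hψ⟩

theorem univ_mem_forced [Nonempty P] (w : CanonicalState n P) (C : Set (Fin n)) :
    Set.univ ∈ w.forced C :=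
  let p := Classical.arbitrary P
  ⟨verum (.atom p), Set.subset_univ _, w.derivable _ (.top C _)⟩

/-- The canonical effectivity function for a non-empty set of agents. -/
def effectivity (w : CanonicalState n P) (C : Set (Fin n)) : Set (Set (CanonicalState n P)) :=
  {X | (C ≠ Set.univ ∧ X ∈ w.forced C) ∨ (C = Set.univ ∧ Xᶜ ∉ w.forced ∅)}

theorem mem_effectivity_univ (w : CanonicalState n P) {X : Set (CanonicalState n P)} :
    X ∈ w.effectivity Set.univ ↔ Xᶜ ∉ w.forced ∅ := by
  simp [effectivity]

theorem mem_effectivity_of_ne (w : CanonicalState n P) {C : Set (Fin n)} (hC : C ≠ Set.univ)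
    {X : Set (CanonicalState n P)} : X ∈ w.effectivity C ↔ X ∈ w.forced C := by
  simp [effectivity, hC]

/-- For `C = N`: were `Xᶜ` forced by `∅`, superadditivity would let `N` force the empty set. -/
theorem forced_subset_effectivity (w : CanonicalState n P) (C : Set (Fin n)) :
    w.forced C ⊆ w.effectivity C := by
  intro X hX
  by_cases hC : C = Set.univ
  · subst hC
    rw [mem_effectivity_univ]
    intro h
    have := w.forced_superadd (Set.inter_empty _) hX h
    rw [Set.inter_compl_self] at this
    exact w.empty_notMem_forced _ this
  · exact (w.mem_effectivity_of_ne hC).2 hX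

/-- If `∅` forced `(X ∩ Y)ᶜ`, it would also force `Y ∩ (X ∩ Y)ᶜ`, which lies inside `Xᶜ`. -/
theorem effectivity_univ_inter (w : CanonicalState n P) {X Y : Set (CanonicalState n P)}
    (hX : X ∈ w.effectivity Set.univ) (hY : Y ∈ w.forced ∅) :
    X ∩ Y ∈ w.effectivity Set.univ := by
  rw [mem_effectivity_univ] at hX ⊢
  intro h
  have := w.forced_superadd (Set.inter_empty _) hY h
  rw [Set.union_empty] at this
  exact hX (w.forced_mono this fun t ht hX => ht.2 ⟨hX, ht.1⟩)

theorem effectivity_isPlayable [Nonempty P] [NeZero n] (w : CanonicalState n P) :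
    IsPlayable w.effectivity := by
  have hne : (∅ : Set (Fin n)) ≠ Set.univ := Set.empty_ne_univ
  refine ⟨fun C => ?_, fun C => w.forced_subset_effectivity C (w.univ_mem_forced C),
    fun C X Y hX hXY => ?_, fun C D X Y hCD hX hY => ?_, fun X => ?_⟩
  · by_cases hC : C = Set.univ
    · subst hC
      rw [mem_effectivity_univ, Set.compl_empty, not_not]
      exact w.univ_mem_forced ∅
    · rw [w.mem_effectivity_of_ne hC]
      exact w.empty_notMem_forced C
  · by_cases hC : C = Set.univ
    · subst hC
      rw [mem_effectivity_univ] at hX ⊢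
      exact fun h => hX (w.forced_mono h (Set.compl_subset_compl.2 hXY))
    · rw [w.mem_effectivity_of_ne hC] at hX ⊢
      exact w.forced_mono hX hXY
  · by_cases hC : C = Set.univ
    · subst hC
      rw [Set.univ_inter] at hCD
      subst hCD
      rw [w.mem_effectivity_of_ne hne] at hY
      rw [Set.union_empty]
      exact w.effectivity_univ_inter hX hY
    by_cases hD : D = Set.univ
    · subst hD
      rw [Set.inter_univ] at hCD
      subst hCD
      rw [w.mem_effectivity_of_ne hne] at hX
      rw [Set.empty_union, Set.inter_comm]
      exact w.effectivity_univ_inter hY hX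
    rw [w.mem_effectivity_of_ne hC] at hX
    rw [w.mem_effectivity_of_ne hD] at hY
    -- `C ∪ D` may still be `N` here, hence the detour through forced sets.
    exact w.forced_subset_effectivity _ (w.forced_superadd hCD hX hY)
  · rw [w.mem_effectivity_of_ne hne, mem_effectivity_univ, compl_compl]

theorem proofSet_mem_effectivity (w : CanonicalState n P) (C : Set (Fin n)) (φ : Formula n P) :
    proofSet φ ∈ w.effectivity C ↔ w.holds (.eff C φ) := by
  by_cases hC : C = Set.univ
  · subst hC
    rw [mem_effectivity_univ, ← proofSet_neg, proofSet_mem_forced, eff_univ_iff]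
  · rw [w.mem_effectivity_of_ne hC, proofSet_mem_forced]

/-- Without agents, the formulas that the only coalition can force make up a canonical state. -/
def successor (w : CanonicalState 0 P) : CanonicalState 0 P where
  holds φ := w.holds (.eff ∅ φ)
  neg φ := by
    rw [← not_iff_comm.1 (w.eff_univ_iff φ).symm, Set.eq_empty_of_isEmpty Set.univ]
  conj φ ψ := by
    refine ⟨fun h => ⟨w.eff_mono (fun t ht => ?_) h, w.eff_mono (fun t ht => ?_) h⟩, fun h => ?_⟩
    · exact ((t.conj _ _).1 ht).1
    · exact ((t.conj _ _).1 ht).2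
    · have := w.eff_superadd (Set.inter_empty _) h.1 h.2
      rwa [Set.union_empty] at this
  derivable φ h := w.eff_of_eq_univ ∅ (Set.eq_univ_of_forall fun t => t.derivable φ h)

theorem exists_isPlayable [Nonempty P] (w : CanonicalState n P) :
    ∃ E : Set (Fin n) → Set (Set (CanonicalState n P)), IsPlayable E ∧
      ∀ C φ, proofSet φ ∈ E C ↔ w.holds (.eff C φ) := by
  rcases n.eq_zero_or_pos with rfl | hn
  -- With `∅ = N`, N-maximality makes `E ∅` contain exactly one of each set and its complement: an
  -- ultrafilter, here the principal one at the successor.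
  · refine ⟨fun _ => {X | w.successor ∈ X}, ⟨fun _ => id, fun _ => trivial,
      fun _ _ _ hX h => h hX, fun _ _ _ _ _ hX hY => ⟨hX, hY⟩, fun _ => Iff.rfl⟩, fun C φ => ?_⟩
    rw [Set.eq_empty_of_isEmpty C]
    exact Iff.rfl
  · have : NeZero n := ⟨hn.ne'⟩
    exact ⟨w.effectivity, w.effectivity_isPlayable, w.proofSet_mem_effectivity⟩

end CanonicalState

/-! ### Truth lemma and completeness -/

theorem IsPlayable.comap_equiv {W : Type v} {W' : Type w} (e : W' ≃ W)
    {E : Set (Fin n) → Set (Set W)} (hE : IsPlayable E) :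
    IsPlayable fun C => {X : Set W' | e.symm ⁻¹' X ∈ E C} where
  liveness := hE.liveness
  safety := hE.safety
  outcomeMono C _ _ hX h := hE.outcomeMono C _ _ hX (Set.preimage_mono h)
  superadditive C D _ _ h hX hY := hE.superadditive C D _ _ h hX hY
  nMaximal _ := hE.nMaximal _

theorem exists_canonicalModel [Nonempty P] (w : CanonicalState n P) :
    ∃ M : CoalitionModel.{u, max u v} n P, M.Playable ∧
      ∃ s : M.W, ∀ φ, M.Sat s φ ↔ w.holds φ := by
  choose E hE hmem using fun w : CanonicalState n P => w.exists_isPlayable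
  let M : CoalitionModel.{u, max u v} n P :=
    { W := ULift.{v} (CanonicalState n P)
      nonempty := ⟨⟨w⟩⟩
      E := fun s C => {X | Equiv.ulift.symm ⁻¹' X ∈ E s.down C}
      V := fun p => {s | s.down.holds (.atom p)} }
  have truth : ∀ φ, M.truthSet φ = ULift.down ⁻¹' CanonicalState.proofSet φ := by
    intro φ
    induction φ with
    | atom p => rfl
    | neg φ ih => rw [CoalitionModel.truthSet, ih, CanonicalState.proofSet_neg]; rfl
    | conj φ ψ ih₁ ih₂ =>
      rw [CoalitionModel.truthSet, ih₁, ih₂, CanonicalState.proofSet_conj]; rfl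
    | eff C φ ih =>
      rw [CoalitionModel.truthSet, ih]
      exact Set.ext fun s => hmem s.down C φ
    | fi C φ ih =>
      rw [CoalitionModel.truthSet, ih]
      refine Set.ext fun s => Iff.trans ?_
        (s.down.holds_iff.1 (s.down.derivable _ (.defFI C φ))).symm
      rw [s.down.conj, s.down.neg, s.down.neg, ← hmem, ← hmem, CanonicalState.proofSet_neg]
      exact Iff.rfl
  refine ⟨M, fun s => (hE s.down).comap_equiv Equiv.ulift, ⟨w⟩, fun φ => ?_⟩
  rw [CoalitionModel.Sat, truth]
  exact Iff.rfl

/-- The grammar has no constants, so `⊤` can only be written down once an atom exists. -/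
theorem Formula.nonempty_atoms (φ : Formula n P) : Nonempty P := by
  induction φ with
  | atom p => exact ⟨p⟩
  | neg _ ih => exact ih
  | conj _ _ ih _ => exact ih
  | eff _ _ ih => exact ih
  | fi _ _ ih => exact ih

theorem Valid.derivable {φ : Formula n P} (h : Valid.{u, max u v} φ) : Derivable φ := by
  have := φ.nonempty_atoms
  refine CanonicalState.derivable_of_forall_holds fun w => ?_
  obtain ⟨M, hM, s, hs⟩ := exists_canonicalModel.{u, v} w
  exact (hs φ).1 (h M hM s)

end Completeness

end CLFI

theorem mainTheorem1 (n : ℕ) (P : Type u) [Countable P] :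
    (∀ φ : CLFI.Formula n P, CLFI.Derivable φ → CLFI.Valid.{u, max u v} φ) ∧
      (∀ φ : CLFI.Formula n P, CLFI.Valid.{u, max u v} φ → CLFI.Derivable φ) :=
  ⟨fun _ => CLFI.Derivable.valid, fun _ => CLFI.Valid.derivable.{u, v}⟩
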